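/- Consider the three-user MIMO interference channel that is constant over time and frequency, with $M$ antennas at each transmitter and $N\ge M$ antennas at each receiver: $H_{ij}\in\mathbb{C}^{N\times M}$ denotes the channel matrix from transmitter $j$ to receiver $i$, for $1\le i,j\le 3$. Let $d\ge 0$ be an integer. Say that alignment with $d$ dimensions per user is feasible for $(H_{ij})$ if there are subspaces $U_1,U_2,U_3\subseteq\mathbb{C}^M$ and $V_1,V_2,V_3\subseteq\mathbb{C}^N$ with $\dim U_i=\dim V_i=d$ for all $i$ and $H_{ij}U_j\perp V_i$ for all $i\ne j$; say that it is feasible with decoding if these subspaces can moreover be chosen such that $\dim \mathrm{Proj}_{V_i}(H_{ii}U_i)=\dim U_i$ for all $i$. Then for generic channel matrices, that is, for all $(H_{ij})$ at which a certain nonzero polynomial in their entries (which may depend on $M,N,d$) does not vanish, the following three conditions are equivalent: alignment is feasible; alignment is feasible with decoding; and $$(2r+1)d\le\max\bigl(rN,(r+1)M\bigr)\quad\text{for all integers } r\ge 0.$$ -/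

import Mathlib

/-- Channel matrices of a three-user MIMO interference channel that is constant over time, with
`M` antennas at every transmitter and `N` at every receiver: `H i j` is the `N × M` complex matrix
from transmitter `j` to receiver `i`. -/
abbrev InterferenceChannel (N M : ℕ) : Type :=
  Fin 3 → Fin 3 → Matrix (Fin N) (Fin M) ℂ

/-- `P` holds for generic channel matrices: it holds for all channels at which some fixed nonzero
polynomial in the entries of all nine matrices does not vanish (that is, on a nonempty Zariski open
set of channels). -/
def ForGenericChannel {N M : ℕ} (P : InterferenceChannel N M → Prop) : Prop :=
  ∃ p : MvPolynomial (Fin 3 × Fin 3 × Fin N × Fin M) ℂ, p ≠ 0 ∧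
    ∀ H : InterferenceChannel N M,
      MvPolynomial.eval (fun k => H k.1 k.2.1 k.2.2.1 k.2.2.2) p ≠ 0 → P H

/-- The image `H i j U` in the signal space of receiver `i` of a subspace `U` of the signal space of
transmitter `j`. -/
noncomputable def receivedSpace {N M : ℕ} (H : InterferenceChannel N M) (i j : Fin 3)
    (U : Submodule ℂ (EuclideanSpace ℂ (Fin M))) : Submodule ℂ (EuclideanSpace ℂ (Fin N)) :=
  U.map (Matrix.toEuclideanLin (H i j))

/-- The subspaces `U j` (at the transmitters) and `V i` (at the receivers) all have dimension `d`,
and `V i` is orthogonal to the signal of every interfering transmitter `j ≠ i`. -/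
structure IsAlignment {N M : ℕ} (H : InterferenceChannel N M) (d : ℕ)
    (U : Fin 3 → Submodule ℂ (EuclideanSpace ℂ (Fin M)))
    (V : Fin 3 → Submodule ℂ (EuclideanSpace ℂ (Fin N))) : Prop where
  finrank_transmit : ∀ j, Module.finrank ℂ (U j) = d
  finrank_receive : ∀ i, Module.finrank ℂ (V i) = d
  orthogonal : ∀ i j, i ≠ j → receivedSpace H i j (U j) ⟂ V i

/-- Decodability: at each receiver `i` the orthogonal projection of the desired signal space
`H i i U i` to `V i` has the same dimension as `U i`. -/
def IsDecodable {N M : ℕ} (H : InterferenceChannel N M)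
    (U : Fin 3 → Submodule ℂ (EuclideanSpace ℂ (Fin M)))
    (V : Fin 3 → Submodule ℂ (EuclideanSpace ℂ (Fin N))) : Prop :=
  ∀ i, Module.finrank ℂ
      ((receivedSpace H i i (U i)).map (V i).starProjection.toLinearMap) =
    Module.finrank ℂ (U i)

/-- Alignment with `d` dimensions per user is feasible for the channel `H`. -/
def AlignmentFeasible {N M : ℕ} (H : InterferenceChannel N M) (d : ℕ) : Prop :=
  ∃ (U : Fin 3 → Submodule ℂ (EuclideanSpace ℂ (Fin M)))
    (V : Fin 3 → Submodule ℂ (EuclideanSpace ℂ (Fin N))), IsAlignment H d U V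

/-- Alignment with `d` dimensions per user is feasible for `H` by subspaces from which every
receiver can also decode its desired signal. -/
def DecodableAlignmentFeasible {N M : ℕ} (H : InterferenceChannel N M) (d : ℕ) : Prop :=
  ∃ (U : Fin 3 → Submodule ℂ (EuclideanSpace ℂ (Fin M)))
    (V : Fin 3 → Submodule ℂ (EuclideanSpace ℂ (Fin N))), IsAlignment H d U V ∧ IsDecodable H U V

/-!
Alignment asks for a subrepresentation of a hexagonal quiver: `H i j` sends `U j` into the
orthogonal complement of `V i`, for `i ≠ j`, and every receiver hears two interferers. Going around
the hexagon, one solves `H i (i + 2) u n = H i (i + 1) u (n + q)`, which makes the vectors of the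
two interferers coincide at receiver `i`; the matrix of this linear system is `alignmentMatrix`.

*Necessity.* For `q = 1` and `r` equations per receiver, the matrix has `3 r N` rows and
`3 (r + 1) M` columns. It maps the families with values in the `U j` into the families with values
in the `(V i)ᗮ`. If it is injective, counting dimensions gives `(2 r + 1) d ≤ r N`; if it is
surjective, counting in the quotient gives `(2 r + 1) d ≤ (r + 1) M`. It has full rank for generic
channels, because it has full rank at `shiftChannel`, where the two interferers use the first and
the last `M` of the `N = M + s` receive antennas and unit vectors go to unit vectors. One violated
inequality is enough for infeasibility, so a single polynomial does.

*Sufficiency for `M < N`.* With `q = min (N - 2 d, s, d)`, the inequalities say exactly that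
`q` chains of unit vectors `e_a, e_(a + s), …` with `d` vectors in total fit into the transmit space
(`chainIndex_lt`). They span aligned `U j` for `shiftChannel`, whose interference fills only
`d + q ≤ N - d` dimensions at each receiver. Since the equations have full rank there, Cramer's rule
lifts these vectors, and then the receive filters, to polynomial functions of the channel
(`exists_kernel_lift`). Decodability is the nonvanishing of a determinant of these polynomials,
which holds at `shiftChannel` with suitable direct links.

*Sufficiency for `M = N`.* The condition is `2 d ≤ M`. The `U j` come from `d` eigenvectors of
the monodromy of the hexagon, and the receive filters from left eigenvectors for `d` other
eigenvalues. These are no longer polynomial in the channel, but they have entries in an integral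
extension of the coordinate ring, and every point of the base lifts to such an extension
(`forGenericChannel_of_frames`).
-/

/-! ### Integral extensions and linear systems over polynomial rings -/

/-- A homomorphism from `R` onto an algebraically closed field extends to every integral extension
of `R`: reduce modulo a maximal ideal over its kernel. -/
theorem exists_ringHom_extension_of_isIntegral {R B k : Type*} [CommRing R] [CommRing B]
    [Algebra R B] [Algebra.IsIntegral R B] [FaithfulSMul R B] [Field k] [IsAlgClosed k]
    (φ : R →+* k) (hφ : Function.Surjective φ) :
    ∃ ψ : B →+* k, ∀ r, ψ (algebraMap R B r) = φ r := by
  have hmax : (RingHom.ker φ).IsMaximal := RingHom.ker_isMaximal_of_surjective φ hφ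
  obtain ⟨n, hn, hlies⟩ :=
    Ideal.exists_maximal_ideal_liesOver_of_isIntegral (S := B) (RingHom.ker φ)
  let _ : Field (R ⧸ RingHom.ker φ) := Ideal.Quotient.field _
  let _ : Field (B ⧸ n) := Ideal.Quotient.field _
  let _ : Algebra (R ⧸ RingHom.ker φ) k := (RingHom.kerLift φ).toAlgebra
  have : Algebra.IsIntegral (R ⧸ RingHom.ker φ) (B ⧸ n) := inferInstance
  have : Algebra.IsAlgebraic (R ⧸ RingHom.ker φ) (B ⧸ n) := inferInstance
  let θ : (B ⧸ n) →ₐ[R ⧸ RingHom.ker φ] k := IsAlgClosed.lift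
  refine ⟨θ.toRingHom.comp (Ideal.Quotient.mk n), fun r => ?_⟩
  have h := θ.commutes (Ideal.Quotient.mk _ r)
  exact h

open Matrix in
/-- If a linear system `A` over `B` has full row rank at the point `ε`, its solutions at `ε` lift to
solutions over `B`. -/
theorem exists_kernel_lift {B k m n l : Type*} [CommRing B] [CommRing k] [Fintype m] [Fintype n]
    [DecidableEq m] (ε : B →+* k) (hε : Function.Surjective ε) (A : Matrix m n B)
    (S₀ : Matrix n m k) (hS : A.map ε * S₀ = 1) (X₀ : Matrix n l k) (hX : A.map ε * X₀ = 0) :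
    ∃ X : Matrix n l B, A * X = 0 ∧ X.map ε = X₀ := by
  obtain ⟨S, rfl⟩ : ∃ S : Matrix n m B, S.map ε = S₀ :=
    ⟨S₀.map (Function.surjInv hε), by ext; simp [Function.surjInv_eq]⟩
  obtain ⟨X, rfl⟩ : ∃ X : Matrix n l B, X.map ε = X₀ :=
    ⟨X₀.map (Function.surjInv hε), by ext; simp [Function.surjInv_eq]⟩
  -- Cramer's rule; the denominator `(A * S).det` takes the value `1` at `ε`.
  refine ⟨(A * S).det • X - S * ((A * S).adjugate * (A * X)), ?_, ?_⟩
  · rw [Matrix.mul_sub, ← Matrix.mul_assoc A S, ← Matrix.mul_assoc (A * S), Matrix.mul_adjugate]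
    simp
  · have h1 : (A * X).map ε = 0 := by rw [Matrix.map_mul, hX]
    have h2 : ε (A * S).det = 1 := by
      rw [RingHom.map_det, RingHom.mapMatrix_apply, Matrix.map_mul, hS, det_one]
    rw [Matrix.map_sub _ (map_sub ε), Matrix.map_mul, Matrix.map_mul, h1]
    ext i j
    simp [h2]

open Matrix in
theorem exists_right_inverse_of_vecMul_eq_zero {k m n : Type*} [Field k] [Fintype m] [Fintype n]
    [DecidableEq m] [DecidableEq n] (A : Matrix m n k) (h : ∀ y, y ᵥ* A = 0 → y = 0) :
    ∃ S : Matrix n m k, A * S = 1 := by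
  obtain ⟨g, hg⟩ := LinearMap.exists_leftInverse_of_injective (Matrix.toLin' Aᵀ) (by
    rw [LinearMap.ker_eq_bot']
    intro y hy
    exact h y (by simpa [Matrix.mulVec_transpose] using hy))
  refine ⟨(LinearMap.toMatrix' g)ᵀ, ?_⟩
  have := congrArg LinearMap.toMatrix' hg
  rw [LinearMap.toMatrix'_comp, LinearMap.toMatrix'_toLin', LinearMap.toMatrix'_id] at this
  rw [← Matrix.transpose_inj, Matrix.transpose_mul, Matrix.transpose_transpose, this,
    Matrix.transpose_one]

open Matrix in
theorem exists_left_inverse_of_mulVec_eq_zero {k m n : Type*} [Field k] [Fintype m] [Fintype n]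
    [DecidableEq m] [DecidableEq n] (A : Matrix m n k) (h : ∀ x, A *ᵥ x = 0 → x = 0) :
    ∃ S : Matrix n m k, S * A = 1 := by
  obtain ⟨S, hS⟩ := exists_right_inverse_of_vecMul_eq_zero Aᵀ (fun y hy => h y (by
    simpa [Matrix.vecMul_transpose] using hy))
  refine ⟨Sᵀ, ?_⟩
  rw [← Matrix.transpose_inj, Matrix.transpose_mul, Matrix.transpose_transpose, hS,
    Matrix.transpose_one]

/-! ### Feasibility from frames over an extension of the coordinate ring -/

/-- The coordinate ring of the space of channels. -/
abbrev ChannelRing (N M : ℕ) : Type := MvPolynomial (Fin 3 × Fin 3 × Fin N × Fin M) ℂ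

/-- The generic channel: its entries are the coordinate functions. -/
noncomputable def genericChannel (N M : ℕ) (i j : Fin 3) :
    Matrix (Fin N) (Fin M) (ChannelRing N M) :=
  Matrix.of fun a b => MvPolynomial.X (i, j, a, b)

/-- Evaluation of coordinate functions at the channel `H`. -/
noncomputable def evalChannel {N M : ℕ} (H : InterferenceChannel N M) : ChannelRing N M →+* ℂ :=
  MvPolynomial.eval (fun k => H k.1 k.2.1 k.2.2.1 k.2.2.2)

theorem genericChannel_map_eval {N M : ℕ} (H : InterferenceChannel N M) (i j : Fin 3) :
    (genericChannel N M i j).map (evalChannel H) = H i j := by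
  ext a b
  simp [genericChannel, evalChannel]

theorem evalChannel_surjective {N M : ℕ} (H : InterferenceChannel N M) :
    Function.Surjective (evalChannel H) :=
  fun c => ⟨MvPolynomial.C c, by simp [evalChannel]⟩

open Matrix in
theorem mulVec_injective_of_det_mul_ne_zero {m n : Type*} [Fintype n] [Fintype m] [DecidableEq n]
    (A : Matrix n m ℂ) (P : Matrix m n ℂ) (h : (A * P).det ≠ 0) (x : n → ℂ) (hx : P *ᵥ x = 0) :
    x = 0 := by
  refine Matrix.eq_zero_of_mulVec_eq_zero h ?_
  rw [← Matrix.mulVec_mulVec, hx, Matrix.mulVec_zero]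

open Matrix in
theorem inner_toEuclideanLin_conjTranspose {m n : Type*} [Fintype m] [Fintype n] [DecidableEq m]
    [DecidableEq n] (Q : Matrix m n ℂ) (x : EuclideanSpace ℂ n) (y : EuclideanSpace ℂ m) :
    inner ℂ (Matrix.toEuclideanLin Qᴴ y) x = inner ℂ y (Matrix.toEuclideanLin Q x) := by
  rw [Matrix.toEuclideanLin_conjTranspose_eq_adjoint, LinearMap.adjoint_inner_left]

open Matrix in
/-- Beamforming matrices `P j` whose images are zero-forced by the receive filters `Q i`, `i ≠ j`,
while every `Q i * H i i * P i` is invertible, give decodable alignment. -/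
theorem decodableAlignmentFeasible_of_frames {N M d : ℕ} (H : InterferenceChannel N M)
    (P : Fin 3 → Matrix (Fin M) (Fin d) ℂ) (Q : Fin 3 → Matrix (Fin d) (Fin N) ℂ)
    (hzero : ∀ i j, i ≠ j → Q i * H i j * P j = 0) (hdet : ∀ i, (Q i * H i i * P i).det ≠ 0) :
    DecodableAlignmentFeasible H d := by
  have hP : ∀ j, Function.Injective (Matrix.toEuclideanLin (P j)) := by
    intro j
    rw [← LinearMap.ker_eq_bot, LinearMap.ker_eq_bot']
    intro x hx
    have := mulVec_injective_of_det_mul_ne_zero _ _ (hdet j) x.ofLp (by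
      simpa [Matrix.toEuclideanLin, Matrix.toLpLin_apply] using hx)
    ext i
    simp [this]
  have hQ : ∀ j, Function.Injective (Matrix.toEuclideanLin (Q j)ᴴ) := by
    intro j
    rw [← LinearMap.ker_eq_bot, LinearMap.ker_eq_bot']
    intro x hx
    have h2 : ((H j j * P j)ᴴ * (Q j)ᴴ).det ≠ 0 := by
      rw [← Matrix.conjTranspose_mul, Matrix.det_conjTranspose, ← Matrix.mul_assoc]
      simpa using hdet j
    have := mulVec_injective_of_det_mul_ne_zero _ _ h2 x.ofLp (by
      simpa [Matrix.toEuclideanLin, Matrix.toLpLin_apply] using hx)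
    ext i
    simp [this]
  have hcomp : ∀ i j x, Matrix.toEuclideanLin (Q i) (Matrix.toEuclideanLin (H i j)
      (Matrix.toEuclideanLin (P j) x)) = WithLp.toLp 2 ((Q i * H i j * P j) *ᵥ x.ofLp) := by
    intro i j x
    simp [Matrix.toEuclideanLin, Matrix.toLpLin_apply, Matrix.mul_assoc]
  refine ⟨fun j => LinearMap.range (Matrix.toEuclideanLin (P j)),
    fun i => LinearMap.range (Matrix.toEuclideanLin (Q i)ᴴ), ⟨?_, ?_, ?_⟩, ?_⟩
  · intro j
    simp [LinearMap.finrank_range_of_inj (hP j)]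
  · intro j
    simp [LinearMap.finrank_range_of_inj (hQ j)]
  · intro i j hij
    rw [Submodule.isOrtho_iff_inner_eq]
    rintro _ ⟨_, ⟨x, rfl⟩, rfl⟩ _ ⟨y, rfl⟩
    rw [← inner_conj_symm, inner_toEuclideanLin_conjTranspose, hcomp, hzero i j hij]
    simp
  · intro i
    rw [receivedSpace, LinearMap.finrank_range_of_inj (hP i), ← LinearMap.range_comp,
      ← LinearMap.range_comp, LinearMap.finrank_range_of_inj]
    rw [← LinearMap.ker_eq_bot, LinearMap.ker_eq_bot']
    intro x hx
    have hx' : Matrix.toEuclideanLin (H i i) (Matrix.toEuclideanLin (P i) x) ∈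
        (LinearMap.range (Matrix.toEuclideanLin (Q i)ᴴ))ᗮ := by
      rw [← Submodule.starProjection_apply_eq_zero_iff]
      exact hx
    have h3 : Matrix.toEuclideanLin (Q i) (Matrix.toEuclideanLin (H i i)
        (Matrix.toEuclideanLin (P i) x)) = 0 := by
      rw [← inner_self_eq_zero (𝕜 := ℂ), ← inner_toEuclideanLin_conjTranspose]
      exact (Submodule.mem_orthogonal _ _).1 hx' _ ⟨_, rfl⟩
    rw [hcomp] at h3
    have := Matrix.eq_zero_of_mulVec_eq_zero (hdet i) (v := x.ofLp) (by
      simpa using h3)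
    ext i
    simp [this]

open Matrix in
/-- Frames for the generic channel with entries in an integral extension of the coordinate ring
specialize to frames for every channel at which some nonzero polynomial does not vanish. -/
theorem forGenericChannel_of_frames {N M d : ℕ} {B : Type*} [CommRing B] [IsDomain B]
    [Algebra (ChannelRing N M) B] [Algebra.IsIntegral (ChannelRing N M) B]
    [FaithfulSMul (ChannelRing N M) B]
    (P : Fin 3 → Matrix (Fin M) (Fin d) B) (Q : Fin 3 → Matrix (Fin d) (Fin N) B)
    (hzero : ∀ i j, i ≠ j →
      Q i * (genericChannel N M i j).map (algebraMap (ChannelRing N M) B) * P j = 0)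
    (hdet : ∀ i,
      (Q i * (genericChannel N M i i).map (algebraMap (ChannelRing N M) B) * P i).det ≠ 0) :
    ForGenericChannel (fun H : InterferenceChannel N M => DecodableAlignmentFeasible H d) := by
  set G : Fin 3 → Fin 3 → Matrix (Fin N) (Fin M) B :=
    fun i j => (genericChannel N M i j).map (algebraMap (ChannelRing N M) B)
  set δ : B := ∏ i, (Q i * G i i * P i).det
  have hδ : δ ≠ 0 := Finset.prod_ne_zero_iff.2 fun i _ => hdet i
  -- A nonzero element of an integral extension divides a nonzero element of the base ring.
  obtain ⟨p, hp, hp0⟩ := Submodule.exists_mem_ne_zero_of_ne_bot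
    (Ideal.comap_ne_bot_of_integral_mem (R := ChannelRing N M) hδ
      (Ideal.mem_span_singleton_self δ) (Algebra.IsIntegral.isIntegral δ))
  obtain ⟨e, he⟩ := Ideal.mem_span_singleton.1 (Ideal.mem_comap.1 hp)
  refine ⟨p, hp0, fun H hH => ?_⟩
  obtain ⟨ψ, hψ⟩ := exists_ringHom_extension_of_isIntegral (B := B) (evalChannel H)
    (evalChannel_surjective H)
  have hG : ∀ i j, (G i j).map ψ = H i j := by
    intro i j
    rw [← genericChannel_map_eval H i j]
    ext a b
    exact hψ _
  have hmap : ∀ i j, (Q i * G i j * P j).map ψ = (Q i).map ψ * H i j * (P j).map ψ := by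
    intro i j
    rw [Matrix.map_mul, Matrix.map_mul, hG]
  refine decodableAlignmentFeasible_of_frames H (fun j => (P j).map ψ) (fun i => (Q i).map ψ)
    (fun i j hij => ?_) (fun i => ?_)
  · rw [← hmap, hzero i j hij]
    ext; simp
  · have h1 : ψ δ ≠ 0 := by
      intro h0
      apply hH
      have := congrArg ψ he
      rw [hψ, map_mul, h0, zero_mul] at this
      exact this
    rw [map_prod] at h1
    have h2 := Finset.prod_ne_zero_iff.1 h1 i (Finset.mem_univ i)
    rwa [RingHom.map_det, RingHom.mapMatrix_apply, hmap] at h2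

/-! ### The alignment equations -/

/-- The matrix of the linear map that sends three families `u j : Fin (m + q) → B ^ M` of transmit
vectors to the receive vectors `H i (i + 2) (u (i + 2) n) - H i (i + 1) (u (i + 1) (n + q))`, for
`i : Fin 3` and `n < m`; the indices of users are modulo `3`. A kernel element consists of transmit
vectors such that, at every receiver, the `n`-th vector of one interferer is aligned with the
`(n + q)`-th vector of the other one. -/
def alignmentMatrix {B : Type*} [CommRing B] {N M : ℕ}
    (H : Fin 3 → Fin 3 → Matrix (Fin N) (Fin M) B) (m q : ℕ) :
    Matrix (Fin 3 × Fin m × Fin N) (Fin 3 × Fin (m + q) × Fin M) B :=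
  Matrix.of fun x y =>
    (if y.1 = x.1 + 2 ∧ y.2.1 = Fin.castAdd q x.2.1 then H x.1 (x.1 + 2) x.2.2 y.2.2 else 0) -
    (if y.1 = x.1 + 1 ∧ y.2.1 = Fin.addNat x.2.1 q then H x.1 (x.1 + 1) x.2.2 y.2.2 else 0)

theorem fin_three_add_two_add_one (i : Fin 3) : i + 2 + 1 = i := by
  revert i; decide

theorem fin_three_add_one_add_two (i : Fin 3) : i + 1 + 2 = i := by
  revert i; decide

theorem fin_three_add_one_add_one (i : Fin 3) : i + 1 + 1 = i + 2 := by
  revert i; decide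

theorem fin_three_eq_add_one {i j : Fin 3} (h : i + 2 = j + 1) : j = i + 1 := by
  revert h; revert i j; decide

theorem fin_three_ne_add_one (i : Fin 3) : i ≠ i + 1 := by
  revert i; decide

theorem fin_three_ne_add_two (i : Fin 3) : i ≠ i + 2 := by
  revert i; decide

theorem alignmentMatrix_map {B C : Type*} [CommRing B] [CommRing C] {N M : ℕ}
    (H : Fin 3 → Fin 3 → Matrix (Fin N) (Fin M) B) (m q : ℕ) (f : B →+* C) :
    (alignmentMatrix H m q).map f = alignmentMatrix (fun i j => (H i j).map f) m q := by
  ext x y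
  simp only [alignmentMatrix, Matrix.map_apply, Matrix.of_apply, map_sub, apply_ite f, map_zero]

open Matrix in
theorem alignmentMatrix_mulVec {B : Type*} [CommRing B] {N M : ℕ}
    (H : Fin 3 → Fin 3 → Matrix (Fin N) (Fin M) B) (m q : ℕ)
    (x : Fin 3 × Fin (m + q) × Fin M → B) (i : Fin 3) (n : Fin m) (a : Fin N) :
    (alignmentMatrix H m q *ᵥ x) (i, n, a) =
      (H i (i + 2) *ᵥ fun b => x (i + 2, Fin.castAdd q n, b)) a -
      (H i (i + 1) *ᵥ fun b => x (i + 1, Fin.addNat n q, b)) a := by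
  simp only [alignmentMatrix, Matrix.mulVec, dotProduct, Matrix.of_apply, sub_mul,
    Finset.sum_sub_distrib, Fintype.sum_prod_type, ite_and, ite_mul, zero_mul,
    Finset.sum_ite_irrel, Finset.sum_const_zero, Finset.sum_ite_eq', Finset.mem_univ, if_true]

/-! ### Full rank at a special channel -/

/-- The special channel with `N = M + s`: at receiver `i`, transmitter `i + 1` uses the first `M`
receive antennas, and transmitter `i + 2` uses the last `M` ones. The direct links are `D`. -/
def shiftChannel (M s : ℕ) (D : Fin 3 → Matrix (Fin (M + s)) (Fin M) ℂ) :
    InterferenceChannel (M + s) M := fun i j =>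
  if j = i + 2 then Matrix.of fun a b => if a = Fin.addNat b s then 1 else 0
  else if j = i + 1 then Matrix.of fun a b => if a = Fin.castAdd s b then 1 else 0
  else D i

theorem shiftChannel_add_two {M s : ℕ} (D : Fin 3 → Matrix (Fin (M + s)) (Fin M) ℂ) (i : Fin 3)
    (a : Fin (M + s)) (b : Fin M) :
    shiftChannel M s D i (i + 2) a b = if a = Fin.addNat b s then 1 else 0 := by
  simp [shiftChannel]

theorem shiftChannel_add_one {M s : ℕ} (D : Fin 3 → Matrix (Fin (M + s)) (Fin M) ℂ) (i : Fin 3)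
    (a : Fin (M + s)) (b : Fin M) :
    shiftChannel M s D i (i + 1) a b = if a = Fin.castAdd s b then 1 else 0 := by
  simp [shiftChannel]

theorem shiftChannel_self {M s : ℕ} (D : Fin 3 → Matrix (Fin (M + s)) (Fin M) ℂ) (i : Fin 3) :
    shiftChannel M s D i i = D i := by
  simp [shiftChannel]

/-- A family of vectors as a function of natural indices, extended by zero. -/
def extendByZero {m N : ℕ} (y : Fin 3 × Fin m × Fin N → ℂ) (i : Fin 3) (n a : ℕ) : ℂ :=
  if h : n < m ∧ a < N then y (i, ⟨n, h.1⟩, ⟨a, h.2⟩) else 0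

theorem eq_zero_of_extendByZero {m N : ℕ} (y : Fin 3 × Fin m × Fin N → ℂ)
    (h : ∀ i n a, extendByZero y i n a = 0) : y = 0 := by
  ext ⟨i, n, a⟩
  simpa [extendByZero] using h i n a

theorem extendByZero_of_le {m N : ℕ} (y : Fin 3 × Fin m × Fin N → ℂ) (i : Fin 3) (n a : ℕ)
    (h : m ≤ n ∨ N ≤ a) : extendByZero y i n a = 0 := by
  rw [extendByZero, dif_neg]
  omega

open Matrix in
/-- The equations for a vector in the left kernel, with indices that may run out of range. -/
theorem extendByZero_of_vecMul_eq_zero {M s m q : ℕ} (D : Fin 3 → Matrix (Fin (M + s)) (Fin M) ℂ)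
    (y : Fin 3 × Fin m × Fin (M + s) → ℂ)
    (hy : y ᵥ* alignmentMatrix (shiftChannel M s D) m q = 0) (i : Fin 3) (k b : ℕ)
    (hk : k < m + q) (hb : b < M) :
    extendByZero y i k (b + s) = if q ≤ k then extendByZero y (i + 1) (k - q) b else 0 := by
  have h := congrFun hy (i + 2, ⟨k, hk⟩, ⟨b, hb⟩)
  simp only [alignmentMatrix, Matrix.vecMul, dotProduct, Matrix.of_apply, mul_sub,
    Finset.sum_sub_distrib, shiftChannel_add_two, shiftChannel_add_one, Pi.zero_apply,
    sub_eq_zero] at h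
  convert h using 1
  · by_cases hkm : k < m
    · rw [Fintype.sum_eq_single (i, ⟨k, hkm⟩, ⟨b + s, by omega⟩)]
      · simp [extendByZero, hkm, hb]
      · rintro ⟨i', n, a⟩ hne
        simp only [← ite_and, mul_ite, mul_one, mul_zero]
        rw [if_neg]
        rintro ⟨⟨h1, h2⟩, h3⟩
        apply hne
        simp only [Fin.ext_iff, Fin.val_castAdd, Fin.val_addNat] at h2 h3
        ext <;> simp_all
    · rw [extendByZero_of_le _ _ _ _ (by omega), Finset.sum_eq_zero]
      rintro ⟨i', n, a⟩ -
      have h2 : ¬ ((⟨k, hk⟩ : Fin (m + q)) = Fin.castAdd q n) := by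
        simp only [Fin.ext_iff, Fin.val_castAdd]; omega
      simp [h2]
  · split_ifs with hkq
    · rw [Fintype.sum_eq_single (i + 1, ⟨k - q, by omega⟩, ⟨b, by omega⟩)]
      · have := (fin_three_add_one_add_one i).symm
        have h4 : k - q < m ∧ b < M + s := by omega
        simp [extendByZero, h4, hkq, ← this]
      · rintro ⟨i', n, a⟩ hne
        simp only [← ite_and, mul_ite, mul_one, mul_zero]
        rw [if_neg]
        rintro ⟨⟨h1, h2⟩, h3⟩
        apply hne
        have h5 : i' = i + 1 := fin_three_eq_add_one h1
        simp only [Fin.ext_iff, Fin.val_castAdd, Fin.val_addNat] at h2 h3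
        subst h5
        simp only [Prod.mk.injEq, Fin.ext_iff, true_and]
        omega
    · rw [Finset.sum_eq_zero]
      rintro ⟨i', n, a⟩ -
      have h2 : ¬ ((⟨k, hk⟩ : Fin (m + q)) = Fin.addNat n q) := by
        simp only [Fin.ext_iff, Fin.val_addNat]; omega
      simp [h2]

/-- The rows of the alignment matrix of the special channel are independent as long as the chains
`e_a, e_(a + s), e_(a + 2 s), …` of aligned unit vectors fit into the transmit space. -/
theorem exists_right_inverse_alignmentMatrix_shiftChannel {M s m q : ℕ}
    (D : Fin 3 → Matrix (Fin (M + s)) (Fin M) ℂ) (hq : m ≠ 0 → 0 < q)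
    (hm : ∀ n < m, (n / q + 1) * s ≤ M) :
    ∃ S : Matrix (Fin 3 × Fin (m + q) × Fin M) (Fin 3 × Fin m × Fin (M + s)) ℂ,
      alignmentMatrix (shiftChannel M s D) m q * S = 1 := by
  refine exists_right_inverse_of_vecMul_eq_zero _ fun y hy => ?_
  have key := extendByZero_of_vecMul_eq_zero D y hy
  -- A left kernel vector vanishes in high coordinates by induction from the start of its chain, and
  -- in low ones by induction from the end.
  have high : ∀ n i a, (n / q + 1) * s ≤ a → extendByZero y i n a = 0 := by
    intro n
    induction n using Nat.strong_induction_on with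
    | _ n ih =>
      intro i a ha
      by_cases hr : m ≤ n ∨ M + s ≤ a
      · exact extendByZero_of_le _ _ _ _ hr
      have hq := hq (by omega)
      obtain ⟨b, rfl⟩ : ∃ b, a = b + s := ⟨a - s, by rw [add_mul] at ha; omega⟩
      rw [key i n b (by omega) (by omega)]
      split_ifs with hqn
      · refine ih _ (by omega) _ _ ?_
        have : n / q = (n - q) / q + 1 := by
          rw [← Nat.add_div_right _ hq, Nat.sub_add_cancel hqn]
        rw [← this]
        rw [add_mul] at ha
        omega
      · rfl
  have low : ∀ l n i a, m ≤ n + l → a < (n / q + 1) * s → extendByZero y i n a = 0 := by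
    intro l
    induction l with
    | zero => exact fun n i a h _ => extendByZero_of_le _ _ _ _ (Or.inl h)
    | succ l ih =>
      intro n i a hn ha
      by_cases hr : m ≤ n
      · exact extendByZero_of_le _ _ _ _ (Or.inl hr)
      have hq := hq (by omega)
      have h := key (i + 2) (n + q) a (by omega) (by have := hm n (by omega); omega)
      have h3 := fin_three_add_two_add_one i
      rw [if_pos (by omega), Nat.add_sub_cancel, h3] at h
      rw [← h]
      refine ih _ _ _ (by omega) ?_
      rw [Nat.add_div_right _ hq, add_mul]
      omega
  refine eq_zero_of_extendByZero y fun i n a => ?_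
  rcases le_or_gt ((n / q + 1) * s) a with h | h
  · exact high n i a h
  · exact low m n i a (by omega) h

open Matrix in
/-- The equations for a vector in the kernel, with indices that may run out of range. -/
theorem extendByZero_of_mulVec_eq_zero {M s m : ℕ} (D : Fin 3 → Matrix (Fin (M + s)) (Fin M) ℂ)
    (x : Fin 3 × Fin (m + 1) × Fin M → ℂ)
    (hx : alignmentMatrix (shiftChannel M s D) m 1 *ᵥ x = 0) (i : Fin 3) (n a : ℕ)
    (hn : n < m) (ha : a < M + s) :
    extendByZero x (i + 1) (n + 1) a = if s ≤ a then extendByZero x (i + 2) n (a - s) else 0 := by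
  have h := (alignmentMatrix_mulVec _ _ _ x i ⟨n, hn⟩ ⟨a, ha⟩).symm.trans (congrFun hx _)
  simp only [Matrix.mulVec, dotProduct, shiftChannel_add_two, shiftChannel_add_one,
    Pi.zero_apply, sub_eq_zero] at h
  refine Eq.trans ?_ (h.symm.trans ?_)
  · by_cases haM : a < M
    · rw [Fintype.sum_eq_single (⟨a, haM⟩ : Fin M)]
      · simp [extendByZero, hn, haM]
      · intro b hb
        rw [if_neg, zero_mul]
        intro h
        apply hb
        simp only [Fin.ext_iff, Fin.val_castAdd] at h ⊢
        omega
    · rw [extendByZero_of_le _ _ _ _ (by omega), Finset.sum_eq_zero]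
      intro b _
      rw [if_neg, zero_mul]
      simp only [Fin.ext_iff, Fin.val_castAdd]
      omega
  · split_ifs with has
    · rw [Fintype.sum_eq_single (⟨a - s, by omega⟩ : Fin M)]
      · have h4 : n < m + 1 ∧ a - s < M := by omega
        simp [extendByZero, h4, has]
      · intro b hb
        rw [if_neg, zero_mul]
        intro h
        apply hb
        simp only [Fin.ext_iff, Fin.val_addNat] at h ⊢
        omega
    · rw [Finset.sum_eq_zero]
      intro b _
      rw [if_neg, zero_mul]
      simp only [Fin.ext_iff, Fin.val_addNat]
      omega

/-- The columns of the alignment matrix of the special channel are independent as soon as the chains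
of aligned unit vectors are too long for the transmit space. -/
theorem exists_left_inverse_alignmentMatrix_shiftChannel {M s m : ℕ}
    (D : Fin 3 → Matrix (Fin (M + s)) (Fin M) ℂ) (hm : M ≤ m * s) :
    ∃ S : Matrix (Fin 3 × Fin (m + 1) × Fin M) (Fin 3 × Fin m × Fin (M + s)) ℂ,
      S * alignmentMatrix (shiftChannel M s D) m 1 = 1 := by
  refine exists_left_inverse_of_mulVec_eq_zero _ fun x hx => ?_
  have key := extendByZero_of_mulVec_eq_zero D x hx
  have low : ∀ n i a, a < n * s → extendByZero x i n a = 0 := by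
    intro n
    induction n with
    | zero => intro i a h; omega
    | succ n ih =>
      intro i a h
      by_cases hr : m + 1 ≤ n + 1 ∨ M ≤ a
      · exact extendByZero_of_le _ _ _ _ hr
      have h3 := fin_three_add_two_add_one i
      have h := key (i + 2) n a (by omega) (by omega)
      rw [h3] at h
      rw [h]
      split_ifs with hs
      · exact ih _ _ (by rw [add_mul] at *; omega)
      · rfl
  have step : ∀ l n i a, n + l = m → extendByZero x i n a = 0 := by
    intro l
    induction l with
    | zero =>
      intro n i a hn
      by_cases hr : M ≤ a
      · exact extendByZero_of_le _ _ _ _ (Or.inr hr)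
      · exact low _ _ _ (by rw [add_zero] at hn; subst hn; omega)
    | succ l ih =>
      intro n i a hn
      by_cases hr : M ≤ a
      · exact extendByZero_of_le _ _ _ _ (Or.inr hr)
      have h3 := fin_three_add_one_add_two i
      have h := key (i + 1) n (a + s) (by omega) (by omega)
      rw [if_pos (by omega), h3, Nat.add_sub_cancel] at h
      rw [← h]
      exact ih _ _ _ (by omega)
  refine eq_zero_of_extendByZero x fun i n a => ?_
  rcases Nat.lt_or_ge m n with h | h
  · exact extendByZero_of_le _ _ _ _ (by omega)
  · exact step (m - n) n i a (by omega)

/-! ### Necessity of the inequalities -/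

section Necessity

variable {N M d : ℕ} {H : InterferenceChannel N M}
  {U : Fin 3 → Submodule ℂ (EuclideanSpace ℂ (Fin M))}
  {V : Fin 3 → Submodule ℂ (EuclideanSpace ℂ (Fin N))}

/-- Families of `k` transmit vectors per user, taken from the subspaces `U j`, in coordinates. -/
noncomputable def transmitCoords (U : Fin 3 → Submodule ℂ (EuclideanSpace ℂ (Fin M))) (k : ℕ) :
    ((p : Fin 3 × Fin k) → U p.1) →ₗ[ℂ] (Fin 3 × Fin k × Fin M → ℂ) where
  toFun w p := (w (p.1, p.2.1)).1.ofLp p.2.2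
  map_add' _ _ := rfl
  map_smul' _ _ := rfl

theorem transmitCoords_injective (U : Fin 3 → Submodule ℂ (EuclideanSpace ℂ (Fin M))) (k : ℕ) :
    Function.Injective (transmitCoords U k) := by
  intro v w h
  ext p b
  exact congrFun h (p.1, p.2, b)

/-- Orthogonal projection of families of `m` receive vectors per user to the subspaces `V i`. -/
noncomputable def receiveProjection (V : Fin 3 → Submodule ℂ (EuclideanSpace ℂ (Fin N))) (m : ℕ) :
    (Fin 3 × Fin m × Fin N → ℂ) →ₗ[ℂ] ((p : Fin 3 × Fin m) → V p.1) :=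
  LinearMap.pi fun p => (V p.1).orthogonalProjectionOnto.toLinearMap ∘ₗ
    { toFun := fun z => WithLp.toLp 2 fun a => z (p.1, p.2, a)
      map_add' := fun _ _ => rfl
      map_smul' := fun _ _ => rfl }

theorem receiveProjection_surjective (V : Fin 3 → Submodule ℂ (EuclideanSpace ℂ (Fin N)))
    (m : ℕ) : Function.Surjective (receiveProjection V m) := by
  intro v
  refine ⟨fun z => (v (z.1, z.2.1)).1.ofLp z.2.2, ?_⟩
  funext p
  exact Submodule.orthogonalProjectionOnto_mem_subspace_eq_self (v p)

open Matrix in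
/-- Interference is orthogonal to the receive spaces, whatever transmit vectors are used. -/
theorem receiveProjection_alignmentMatrix (h : IsAlignment H d U V) (m q : ℕ)
    (w : (p : Fin 3 × Fin (m + q)) → U p.1) :
    receiveProjection V m (alignmentMatrix H m q *ᵥ transmitCoords U (m + q) w) = 0 := by
  funext ⟨i, n⟩
  have hmem : ∀ j, i ≠ j → ∀ u : U j, Matrix.toEuclideanLin (H i j) u.1 ∈ (V i)ᗮ :=
    fun j hj u => h.orthogonal i j hj ⟨u.1, u.2, rfl⟩
  have h1 := fin_three_ne_add_one i
  have h2 := fin_three_ne_add_two i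
  have h3 := Submodule.sub_mem _ (hmem _ h2 (w (i + 2, Fin.castAdd q n)))
    (hmem _ h1 (w (i + 1, Fin.addNat n q)))
  rw [← Submodule.orthogonalProjectionOnto_eq_zero_iff] at h3
  refine Eq.trans (congrArg (V i).orthogonalProjectionOnto ?_) h3
  ext a
  refine (alignmentMatrix_mulVec H m q (transmitCoords U (m + q) w) i n a).trans ?_
  simp only [Matrix.toEuclideanLin, Matrix.toLpLin_apply, PiLp.sub_apply]
  rfl

open Matrix in
theorem dim_le_of_alignmentMatrix_injective (h : IsAlignment H d U V) (m q : ℕ)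
    (hinj : ∀ x, alignmentMatrix H m q *ᵥ x = 0 → x = 0) :
    (2 * m + q) * d ≤ m * N := by
  let f : ((p : Fin 3 × Fin (m + q)) → U p.1) →ₗ[ℂ] (Fin 3 × Fin m × Fin N → ℂ) :=
    (alignmentMatrix H m q).mulVecLin ∘ₗ transmitCoords U (m + q)
  have hf : Function.Injective f := by
    refine Function.Injective.comp (g := (alignmentMatrix H m q).mulVecLin) ?_
      (transmitCoords_injective U (m + q))
    rw [← LinearMap.ker_eq_bot, LinearMap.ker_eq_bot']
    exact hinj
  have h1 : LinearMap.range f ≤ LinearMap.ker (receiveProjection V m) := by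
    rintro _ ⟨w, rfl⟩
    exact receiveProjection_alignmentMatrix h m q w
  have h2 := Submodule.finrank_mono h1
  have h3 := LinearMap.finrank_range_add_finrank_ker (receiveProjection V m)
  rw [LinearMap.range_eq_top.2 (receiveProjection_surjective V m), finrank_top] at h3
  rw [LinearMap.finrank_range_of_inj hf] at h2
  simp only [Module.finrank_pi_fintype, h.finrank_transmit, h.finrank_receive, Finset.sum_const,
    Finset.card_univ, Fintype.card_prod, Fintype.card_fin, smul_eq_mul, Module.finrank_self,
    mul_one] at h2 h3
  nlinarith

open Matrix in
theorem dim_le_of_alignmentMatrix_surjective (h : IsAlignment H d U V) (m q : ℕ)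
    (hsurj : Function.Surjective (alignmentMatrix H m q).mulVecLin) :
    (2 * m + q) * d ≤ (m + q) * M := by
  let f : (Fin 3 × Fin (m + q) × Fin M → ℂ) →ₗ[ℂ] ((p : Fin 3 × Fin m) → V p.1) :=
    receiveProjection V m ∘ₗ (alignmentMatrix H m q).mulVecLin
  have hf : Function.Surjective f := (receiveProjection_surjective V m).comp hsurj
  have h1 : LinearMap.range (transmitCoords U (m + q)) ≤ LinearMap.ker f := by
    rintro _ ⟨w, rfl⟩
    exact receiveProjection_alignmentMatrix h m q w
  have h2 := Submodule.finrank_mono h1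
  have h3 := LinearMap.finrank_range_add_finrank_ker f
  rw [LinearMap.range_eq_top.2 hf, finrank_top] at h3
  rw [LinearMap.finrank_range_of_inj (transmitCoords_injective U (m + q))] at h2
  simp only [Module.finrank_pi_fintype, h.finrank_transmit, h.finrank_receive, Finset.sum_const,
    Finset.card_univ, Fintype.card_prod, Fintype.card_fin, smul_eq_mul, Module.finrank_self,
    mul_one] at h2 h3
  nlinarith

end Necessity

open Matrix in
/-- For every fixed `r`, the inequality is necessary on the open set where the alignment matrix has
full rank. -/
theorem forGenericChannel_le_of_alignmentFeasible (M s d r : ℕ) :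
    ForGenericChannel (fun H : InterferenceChannel (M + s) M => AlignmentFeasible H d →
      (2 * r + 1) * d ≤ max (r * (M + s)) ((r + 1) * M)) := by
  have hmap : ∀ H : InterferenceChannel (M + s) M,
      (alignmentMatrix (genericChannel (M + s) M) r 1).map (evalChannel H) =
        alignmentMatrix H r 1 := by
    intro H
    simp only [alignmentMatrix_map, genericChannel_map_eval]
  have hC : ∀ (H : InterferenceChannel (M + s) M) {m n : Type} (S : Matrix m n ℂ),
      (S.map (MvPolynomial.C : ℂ →+* ChannelRing (M + s) M)).map (evalChannel H) = S := by
    intro H m n S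
    ext; simp [evalChannel]
  rcases le_total M (r * s) with hM | hM
  · obtain ⟨S, hS⟩ := exists_left_inverse_alignmentMatrix_shiftChannel (M := M) (s := s)
      (m := r) 0 hM
    set p := (S.map (MvPolynomial.C : ℂ →+* ChannelRing (M + s) M) *
      alignmentMatrix (genericChannel (M + s) M) r 1).det with hp
    have heval : ∀ H, evalChannel H p = (S * alignmentMatrix H r 1).det := by
      intro H
      rw [hp, RingHom.map_det, RingHom.mapMatrix_apply, Matrix.map_mul, hmap, hC]
    refine ⟨p, ?_, fun H hH => ?_⟩
    · intro h0
      have := heval (shiftChannel M s 0)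
      rw [hS, h0, map_zero, Matrix.det_one] at this
      exact zero_ne_one this
    · rintro ⟨U, V, h⟩
      refine le_max_of_le_left (dim_le_of_alignmentMatrix_injective h r 1 fun x hx => ?_)
      exact mulVec_injective_of_det_mul_ne_zero S _ (heval H ▸ hH) x hx
  · obtain ⟨S, hS⟩ := exists_right_inverse_alignmentMatrix_shiftChannel (M := M) (s := s) (m := r)
      (q := 1) 0 (fun _ => one_pos) (fun n hn => by
        rw [Nat.div_one]
        exact (Nat.mul_le_mul_right s hn).trans hM)
    set p := (alignmentMatrix (genericChannel (M + s) M) r 1 *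
      S.map (MvPolynomial.C : ℂ →+* ChannelRing (M + s) M)).det with hp
    have heval : ∀ H, evalChannel H p = (alignmentMatrix H r 1 * S).det := by
      intro H
      rw [hp, RingHom.map_det, RingHom.mapMatrix_apply, Matrix.map_mul, hmap, hC]
    refine ⟨p, ?_, fun H hH => ?_⟩
    · intro h0
      have := heval (shiftChannel M s 0)
      rw [hS, h0, map_zero, Matrix.det_one] at this
      exact zero_ne_one this
    · rintro ⟨U, V, h⟩
      refine le_max_of_le_right (dim_le_of_alignmentMatrix_surjective h r 1 fun z => ?_)
      have hu : IsUnit (alignmentMatrix H r 1 * S).det :=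
        isUnit_iff_ne_zero.2 (heval H ▸ hH)
      refine ⟨S *ᵥ ((alignmentMatrix H r 1 * S)⁻¹ *ᵥ z), ?_⟩
      rw [Matrix.mulVecLin_apply, Matrix.mulVec_mulVec, Matrix.mulVec_mulVec,
        Matrix.mul_nonsing_inv _ hu, Matrix.one_mulVec]

/-! ### Sufficiency for fewer transmit than receive antennas -/

/-- The position of the `n`-th unit vector of the alignment chains in the special channel: the
chains start at `0, …, q - 1` and advance by steps of `s`. -/
def chainIndex (q s n : ℕ) : ℕ := n / q * s + n % q

theorem chainIndex_add {q : ℕ} (hq : 0 < q) (s n : ℕ) :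
    chainIndex q s (n + q) = chainIndex q s n + s := by
  simp only [chainIndex, Nat.add_div_right _ hq, Nat.add_mod_right, add_mul]
  omega

theorem chainIndex_injective {q s : ℕ} (hq : 0 < q) (hqs : q ≤ s) :
    Function.Injective (chainIndex q s) := by
  intro a b h
  have ha := Nat.mod_lt a hq
  have hb := Nat.mod_lt b hq
  have hmod : ∀ n, chainIndex q s n % s = n % q := by
    intro n
    rw [chainIndex, Nat.mul_add_mod', Nat.mod_eq_of_lt ((Nat.mod_lt n hq).trans_le hqs)]
  have hdiv : ∀ n, chainIndex q s n / s = n / q := by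
    intro n
    rw [chainIndex, add_comm, Nat.add_mul_div_right _ _ (by omega),
      Nat.div_eq_of_lt ((Nat.mod_lt n hq).trans_le hqs), zero_add]
  rw [← Nat.div_add_mod a q, ← Nat.div_add_mod b q, ← hdiv, ← hdiv, ← hmod, ← hmod, h]

open Matrix in
/-- If `q` chains of aligned unit vectors with `m + q` vectors in total fit into the transmit space
of the special channel, and if the `m + 2 * q` dimensions of interference leave enough room at the
receivers, then alignment with decoding is generically feasible. -/
theorem forGenericChannel_decodable_of_chains {M s m q : ℕ} (hq : 0 < q) (hqs : q ≤ s)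
    (hN : 2 * (m + q) + q ≤ M + s) (hτ : ∀ n < m + q, chainIndex q s n < M) :
    ForGenericChannel (fun H : InterferenceChannel (M + s) M =>
      DecodableAlignmentFeasible H (m + q)) := by
  have hinj := chainIndex_injective hq hqs
  have hτN : ∀ n < m + q + q, chainIndex q s n < M + s := by
    intro n hn
    rcases lt_or_ge n q with h | h
    · rw [chainIndex, Nat.div_eq_of_lt h, Nat.mod_eq_of_lt h]
      omega
    · rw [← Nat.sub_add_cancel h, chainIndex_add hq]
      have := hτ (n - q) (by omega)
      omega
  let τ : Fin (m + q) → Fin M := fun n => ⟨chainIndex q s n, hτ n n.2⟩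
  let σ : Fin (m + q + q) → Fin (M + s) := fun n => ⟨chainIndex q s n, hτN n n.2⟩
  have hτinj : Function.Injective τ := fun a b h =>
    Fin.ext (hinj (congrArg Fin.val h))
  have hσinj : Function.Injective σ := fun a b h =>
    Fin.ext (hinj (congrArg Fin.val h))
  obtain ⟨c⟩ : Nonempty (Fin (m + q) ↪ {a // a ∉ Set.range σ}) := by
    apply Function.Embedding.nonempty_of_card_le
    classical
    have h1 : Fintype.card {a // a ∈ Set.range σ} = m + q + q := by
      rw [Set.card_range_of_injective hσinj, Fintype.card_fin]
    rw [Fintype.card_subtype_compl, h1, Fintype.card_fin, Fintype.card_fin]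
    omega
  classical
  -- The direct links carry the chains to antennas that see no interference.
  let D : Matrix (Fin (M + s)) (Fin M) ℂ :=
    Matrix.of fun a b => if ∃ k, a = (c k).1 ∧ b = τ k then 1 else 0
  let H₀ : InterferenceChannel (M + s) M := shiftChannel M s fun _ => D
  have hH₀1 : ∀ i a b, H₀ i (i + 1) a b = if a = Fin.castAdd s b then 1 else 0 :=
    shiftChannel_add_one _
  have hH₀2 : ∀ i a b, H₀ i (i + 2) a b = if a = Fin.addNat b s then 1 else 0 :=
    shiftChannel_add_two _
  have hH₀ : ∀ i, H₀ i i = D := shiftChannel_self _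
  let ε := evalChannel H₀
  have hε : Function.Surjective ε := evalChannel_surjective H₀
  let G := genericChannel (M + s) M
  have hG : ∀ i j, (G i j).map ε = H₀ i j := genericChannel_map_eval H₀
  have hA : (alignmentMatrix G m q).map ε = alignmentMatrix H₀ m q := by
    rw [alignmentMatrix_map]
    exact congrArg (fun H => alignmentMatrix H m q) (funext fun i => funext fun j => hG i j)
  -- The transmit vectors: lift the aligned unit vectors of the special channel.
  obtain ⟨S, hS⟩ := exists_right_inverse_alignmentMatrix_shiftChannel (M := M) (s := s) (m := m)
    (q := q) (fun _ => D) (fun _ => hq) (fun n hn => by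
      have := hτ (n + q) (by omega)
      rw [chainIndex_add hq, chainIndex] at this
      rw [add_mul]
      omega)
  have hcol : ∀ (A : Matrix (Fin (M + s)) (Fin M) ℂ) (t : Fin M) (a : Fin (M + s)),
      (A *ᵥ fun b => if b = t then 1 else 0) a = A a t := by
    intro A t a
    simp [Matrix.mulVec, dotProduct]
  obtain ⟨X, hX, hX₀⟩ := exists_kernel_lift ε hε (alignmentMatrix G m q) S (by rw [hA, hS])
    (Matrix.of fun (p : Fin 3 × Fin (m + q) × Fin M) (_ : Unit) =>
      if p.2.2 = τ p.2.1 then (1 : ℂ) else 0) (by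
    rw [hA]
    ext ⟨i, n, a⟩ u
    refine (alignmentMatrix_mulVec H₀ m q
      (fun p => if p.2.2 = τ p.2.1 then (1 : ℂ) else 0) i n a).trans ?_
    have h1 : (τ (Fin.castAdd q n)).addNat s = Fin.castAdd s (τ (n.addNat q)) :=
      Fin.ext (chainIndex_add hq s n).symm
    simp only [hcol, hH₀1, hH₀2, h1, sub_self]
    rfl)
  let P : Fin 3 → Matrix (Fin M) (Fin (m + q)) (ChannelRing (M + s) M) :=
    fun j => Matrix.of fun b k => X (j, k, b) ()
  have hP₀ : ∀ j, (P j).map ε = Matrix.of fun b k => if b = τ k then (1 : ℂ) else 0 := by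
    intro j
    ext b k
    exact congrFun (congrFun hX₀ (j, k, b)) ()
  have hPalign : ∀ i (n : Fin m) a, (G i (i + 2) * P (i + 2)) a (Fin.castAdd q n) =
      (G i (i + 1) * P (i + 1)) a (Fin.addNat n q) := by
    intro i n a
    have h := (alignmentMatrix_mulVec G m q (fun p => X p ()) i n a).symm.trans
      (congrFun (congrFun hX (i, n, a)) ())
    exact sub_eq_zero.1 h
  -- The interference at receiver `i` is spanned by `m + 2 * q` vectors.
  let W : Fin 3 → Matrix (Fin (M + s)) (Fin (m + q + q)) (ChannelRing (M + s) M) := fun i =>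
    Matrix.of fun a => Fin.addCases (fun k => (G i (i + 1) * P (i + 1)) a k)
      (fun e => (G i (i + 2) * P (i + 2)) a (Fin.natAdd m e))
  have hcol' : ∀ {ι : Type} (A : Matrix ι (Fin M) ℂ) (a : ι) (k : Fin (m + q)),
      (A * Matrix.of fun b k => if b = τ k then (1 : ℂ) else 0) a k = A a (τ k) := by
    intro ι A a k
    simp [Matrix.mul_apply]
  have hGP : ∀ i j a k, ε ((G i j * P j) a k) = H₀ i j a (τ k) := by
    intro i j a k
    have h := congrFun (congrFun (Matrix.map_mul (L := G i j) (M := P j) (f := ε)) a) k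
    rw [hG, hP₀] at h
    exact h.trans (hcol' _ a k)
  have hW₀ : ∀ i, (W i).map ε = Matrix.of fun a k => if a = σ k then (1 : ℂ) else 0 := by
    intro i
    ext a k
    refine Fin.addCases (fun k => ?_) (fun e => ?_) k
    · simp only [W, Matrix.map_apply, Matrix.of_apply, Fin.addCases_left]
      rw [hGP, hH₀1]
      rfl
    · simp only [W, Matrix.map_apply, Matrix.of_apply, Fin.addCases_right]
      rw [hGP, hH₀2]
      have h1 : (τ (Fin.natAdd m e)).addNat s = σ (Fin.natAdd (m + q) e) := by
        refine Fin.ext ((chainIndex_add hq s _).symm.trans ?_)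
        simp only [Fin.val_natAdd, σ]
        congr 1
        omega
      rw [h1]
  -- The receive filters: lift a projection to antennas that see no interference.
  have hQex : ∀ i, ∃ Q : Matrix (Fin (m + q)) (Fin (M + s)) (ChannelRing (M + s) M),
      Q * W i = 0 ∧ Q.map ε = Matrix.of fun k a => if a = (c k).1 then (1 : ℂ) else 0 := by
    intro i
    obtain ⟨Z, hZ, hZ₀⟩ := exists_kernel_lift ε hε (W i)ᵀ
      (Matrix.of fun a k => if a = σ k then (1 : ℂ) else 0) (by
        rw [Matrix.transpose_map, hW₀]
        ext k k'
        simp [Matrix.mul_apply, Matrix.one_apply, hσinj.eq_iff, eq_comm])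
      (Matrix.of fun a k => if a = (c k).1 then (1 : ℂ) else 0) (by
        rw [Matrix.transpose_map, hW₀]
        ext k k'
        simp only [Matrix.mul_apply, Matrix.transpose_apply, Matrix.of_apply, Matrix.zero_apply]
        refine Finset.sum_eq_zero fun a _ => ?_
        have h2 : σ k ≠ (c k').1 := fun h => (c k').2 ⟨k, h⟩
        by_cases ha : a = σ k
        · rw [if_neg (c := a = (c k').1) (by rw [ha]; exact h2), mul_zero]
        · rw [if_neg ha, zero_mul])
    refine ⟨Zᵀ, ?_, ?_⟩
    · rw [← Matrix.transpose_inj, Matrix.transpose_mul, Matrix.transpose_transpose, hZ,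
        Matrix.transpose_zero]
    · rw [Matrix.transpose_map, hZ₀]
      rfl
  choose Q hQW hQ₀ using hQex
  have hzero1 : ∀ i, Q i * G i (i + 1) * P (i + 1) = 0 := by
    intro i
    refine Matrix.ext fun k k' => ?_
    have := congrFun (congrFun (hQW i) k) (Fin.castAdd q k')
    rw [Matrix.mul_assoc, Matrix.mul_apply]
    simpa only [Matrix.mul_apply (M := Q i), W, Matrix.of_apply, Fin.addCases_left,
      Matrix.zero_apply] using this
  have hzero2 : ∀ i, Q i * G i (i + 2) * P (i + 2) = 0 := by
    intro i
    refine Matrix.ext fun k k' => ?_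
    refine Fin.addCases (fun n => ?_) (fun e => ?_) k'
    · have := congrFun (congrFun (hzero1 i) k) (Fin.addNat n q)
      rw [Matrix.mul_assoc, Matrix.mul_apply] at this ⊢
      simpa only [hPalign, Matrix.zero_apply] using this
    · have := congrFun (congrFun (hQW i) k) (Fin.natAdd (m + q) e)
      rw [Matrix.mul_assoc, Matrix.mul_apply]
      simpa only [Matrix.mul_apply (M := Q i), W, Matrix.of_apply, Fin.addCases_right,
        Matrix.zero_apply] using this
  refine forGenericChannel_of_frames P Q (fun i j hij => ?_) (fun i => ?_)
  · have : j = i + 1 ∨ j = i + 2 := by clear * - hij; revert i j; decide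
    rcases this with rfl | rfl
    · exact hzero1 i
    · exact hzero2 i
  · intro h
    have h1 := congrArg ε h
    rw [RingHom.map_det, RingHom.mapMatrix_apply] at h1
    have h2 : (Q i * G i i * P i).map ε = 1 := by
      rw [Matrix.map_mul, Matrix.map_mul, hG, hP₀, hQ₀, hH₀]
      ext k k'
      refine (hcol' _ k k').trans ?_
      simp [Matrix.mul_apply, D, Matrix.one_apply, Subtype.val_inj, hτinj.eq_iff, eq_comm]
    refine one_ne_zero (α := ℂ) ?_
    rw [← Matrix.det_one (n := Fin (m + q)), ← h2]
    simpa using h1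

/-! ### Sufficiency for equally many antennas -/

open Polynomial in
/-- If a polynomial over `B` splits, each root of its image under a ring homomorphism is the image
of a root. -/
theorem exists_root_of_root_map {B k : Type*} [CommRing B] [CommRing k] [IsDomain k] (φ : B →+* k)
    (f : B[X]) (t : Multiset B) (hf : f = (t.map fun μ => X - C μ).prod) (r : k)
    (hr : (f.map φ).eval r = 0) : ∃ μ, f.eval μ = 0 ∧ φ μ = r := by
  have h1 : (f.map φ).eval r = (t.map fun μ => r - φ μ).prod := by
    rw [hf, Polynomial.map_multiset_prod, eval_multiset_prod, Multiset.map_map, Multiset.map_map]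
    simp
  rw [h1, Multiset.prod_eq_zero_iff, Multiset.mem_map] at hr
  obtain ⟨μ, hμ, h⟩ := hr
  refine ⟨μ, ?_, (sub_eq_zero.1 h).symm⟩
  rw [hf, eval_multiset_prod, Multiset.map_map]
  refine Multiset.prod_eq_zero (Multiset.mem_map.2 ⟨μ, hμ, ?_⟩)
  simp

open Polynomial in
theorem exists_multiset_prod_of_monic_integralClosure {R L : Type*} [CommRing R] [Field L]
    [IsAlgClosed L] [Algebra R L] (f : (integralClosure R L)[X]) (hf : f.Monic) :
    ∃ t : Multiset (integralClosure R L), f = (t.map fun μ => X - C μ).prod := by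
  let ι : integralClosure R L →+* L := algebraMap (integralClosure R L) L
  have hι : Function.Injective ι := Subtype.val_injective
  have hroots : ∀ μ ∈ (f.map ι).roots, μ ∈ integralClosure R L := by
    intro μ hμ
    have h0 : eval₂ ι μ f = 0 := by
      rw [← eval_map]
      exact (mem_roots'.1 hμ).2
    have h1 : IsIntegral (integralClosure R L) μ := ⟨f, hf, h0⟩
    exact isIntegral_trans μ h1
  obtain ⟨t, ht⟩ : ∃ t : Multiset (integralClosure R L), t.map ι = (f.map ι).roots := by
    lift (f.map ι).roots to Multiset (integralClosure R L) using hroots with t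
    exact ⟨t, rfl⟩
  refine ⟨t, Polynomial.map_injective ι hι ?_⟩
  have h2 := (IsAlgClosed.splits (f.map ι)).eq_prod_roots_of_monic (hf.map ι)
  rw [h2, ← ht, Polynomial.map_multiset_prod, Multiset.map_map, Multiset.map_map]
  simp

section Square

open Matrix

variable {B n l l' : Type*} [CommRing B] [Fintype n] [DecidableEq n]

/-- The monodromy of the interference cycle of a square channel, with adjugates in place of
inverses. -/
def interferenceCycle (H : Fin 3 → Fin 3 → Matrix n n B) : Matrix n n B :=
  (H 2 0).adjugate * (H 2 1 * ((H 0 1).adjugate * (H 0 2 * ((H 1 2).adjugate * H 1 0))))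

/-- Transmit frames that continue the vectors `X` of transmitter `0` along the interference
cycle. -/
def cycleTransmit (H : Fin 3 → Fin 3 → Matrix n n B) (X : Matrix n l B) : Fin 3 → Matrix n l B :=
  ![X, (H 0 1).adjugate * (H 0 2 * ((H 1 2).adjugate * (H 1 0 * X))),
    (H 1 2).adjugate * (H 1 0 * X)]

/-- Receive filters that continue the covectors `Y` of transmitter `0` along the interference
cycle. -/
def cycleReceive (H : Fin 3 → Fin 3 → Matrix n n B) (Y : Matrix l n B) : Fin 3 → Matrix l n B :=
  ![Y * ((H 1 0).adjugate * (H 1 2 * (H 0 2).adjugate)), Y * (H 1 0).adjugate,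
    Y * (H 2 0).adjugate]

theorem cycleReceive_mul_cycleTransmit [Fintype l] (H : Fin 3 → Fin 3 → Matrix n n B)
    (X : Matrix n l B) (Y : Matrix l' n B) (Λ : Matrix l l B) (hX : interferenceCycle H * X = X * Λ)
    (hYX : Y * X = 0) (i j : Fin 3) (hij : i ≠ j) :
    cycleReceive H Y i * H i j * cycleTransmit H X j = 0 := by
  have h1 : ∀ (A : Matrix n n B) (Z : Matrix n l B), A.adjugate * (A * Z) = A.det • Z := by
    intro A Z
    rw [← Matrix.mul_assoc, Matrix.adjugate_mul, Matrix.smul_mul, Matrix.one_mul]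
  have h2 : ∀ (A : Matrix n n B) (Z : Matrix n l B), A * (A.adjugate * Z) = A.det • Z := by
    intro A Z
    rw [← Matrix.mul_assoc, Matrix.mul_adjugate, Matrix.smul_mul, Matrix.one_mul]
  simp only [interferenceCycle, Matrix.mul_assoc] at hX
  have hYX' : Y * (X * Λ) = 0 := by rw [← Matrix.mul_assoc, hYX, Matrix.zero_mul]
  fin_cases i <;> fin_cases j <;>
    first
    | exact absurd rfl hij
    | simp [cycleReceive, cycleTransmit, Matrix.mul_assoc, h1, h2, hX, hYX, hYX']

/-- Eigenvectors of a matrix as columns, from the adjugates of its characteristic matrix at the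
roots `μ k` of the characteristic polynomial. -/
def eigenColumns (T : Matrix n n B) (μ : l → B) : Matrix n l B :=
  Matrix.of fun a k => ∑ b, (Matrix.scalar n (μ k) - T).adjugate a b

/-- Left eigenvectors of a matrix as rows, from the adjugates of its characteristic matrix. -/
def eigenRows (T : Matrix n n B) (μ : l → B) : Matrix l n B :=
  Matrix.of fun k a => ∑ b, (Matrix.scalar n (μ k) - T).adjugate b a

theorem mul_eigenColumns [Fintype l] [DecidableEq l] (T : Matrix n n B) (μ : l → B)
    (hμ : ∀ k, T.charpoly.eval (μ k) = 0) :
    T * eigenColumns T μ = eigenColumns T μ * Matrix.diagonal μ := by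
  ext a k
  have h := Matrix.mul_adjugate (Matrix.scalar n (μ k) - T)
  rw [← Matrix.eval_charpoly, hμ, zero_smul, Matrix.sub_mul, sub_eq_zero] at h
  rw [Matrix.mul_diagonal, Matrix.mul_apply]
  simp only [eigenColumns, Matrix.of_apply, Finset.mul_sum]
  rw [Finset.sum_comm, Finset.sum_mul]
  refine Finset.sum_congr rfl fun b _ => ?_
  rw [← Matrix.mul_apply, ← h]
  simp [Matrix.scalar_apply, Matrix.diagonal_mul, mul_comm]

theorem eigenRows_mul [Fintype l] [DecidableEq l] (T : Matrix n n B) (μ : l → B)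
    (hμ : ∀ k, T.charpoly.eval (μ k) = 0) :
    eigenRows T μ * T = Matrix.diagonal μ * eigenRows T μ := by
  ext k a
  have h := Matrix.adjugate_mul (Matrix.scalar n (μ k) - T)
  rw [← Matrix.eval_charpoly, hμ, zero_smul, Matrix.mul_sub, sub_eq_zero] at h
  rw [Matrix.diagonal_mul, Matrix.mul_apply]
  simp only [eigenRows, Matrix.of_apply, Finset.sum_mul]
  rw [Finset.sum_comm, Finset.mul_sum]
  refine Finset.sum_congr rfl fun b _ => ?_
  rw [← Matrix.mul_apply, ← h]
  simp [Matrix.scalar_apply, Matrix.mul_diagonal, mul_comm]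

theorem eigenRows_mul_eigenColumns [IsDomain B] [Fintype l] [DecidableEq l] [Fintype l']
    [DecidableEq l'] (T : Matrix n n B) (μ : l → B) (ν : l' → B)
    (hμ : ∀ k, T.charpoly.eval (μ k) = 0) (hν : ∀ k, T.charpoly.eval (ν k) = 0)
    (hne : ∀ k k', μ k ≠ ν k') : eigenRows T μ * eigenColumns T ν = 0 := by
  have h : Matrix.diagonal μ * (eigenRows T μ * eigenColumns T ν) =
      eigenRows T μ * eigenColumns T ν * Matrix.diagonal ν := by
    rw [← Matrix.mul_assoc, ← eigenRows_mul T μ hμ, Matrix.mul_assoc, mul_eigenColumns T ν hν,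
      Matrix.mul_assoc]
  ext k k'
  have h' := congrFun (congrFun h k) k'
  rw [Matrix.diagonal_mul, Matrix.mul_diagonal, mul_comm, ← sub_eq_zero, ← mul_sub] at h'
  exact (mul_eq_zero.1 h').resolve_right (sub_ne_zero.2 (hne k k'))

variable {C : Type*} [CommRing C]

theorem map_adjugate_apply (f : B →+* C) (A : Matrix n n B) :
    A.adjugate.map f = (A.map f).adjugate :=
  RingHom.map_adjugate f A

theorem eigenColumns_map (f : B →+* C) (T : Matrix n n B) (μ : l → B) :
    (eigenColumns T μ).map f = eigenColumns (T.map f) (f ∘ μ) := by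
  ext a k
  have h : (Matrix.scalar n (μ k) - T).map f = Matrix.scalar n (f (μ k)) - T.map f := by
    rw [Matrix.map_sub _ (map_sub f)]
    simp [Matrix.scalar_apply, Matrix.diagonal_map]
  simp only [eigenColumns, Matrix.map_apply, Matrix.of_apply, map_sum, Function.comp_apply, ← h,
    ← map_adjugate_apply]

theorem eigenRows_map (f : B →+* C) (T : Matrix n n B) (μ : l → B) :
    (eigenRows T μ).map f = eigenRows (T.map f) (f ∘ μ) := by
  ext a k
  have h : (Matrix.scalar n (μ a) - T).map f = Matrix.scalar n (f (μ a)) - T.map f := by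
    rw [Matrix.map_sub _ (map_sub f)]
    simp [Matrix.scalar_apply, Matrix.diagonal_map]
  simp only [eigenRows, Matrix.map_apply, Matrix.of_apply, map_sum, Function.comp_apply, ← h,
    ← map_adjugate_apply]

theorem adjugate_scalar_sub_diagonal (v : n → B) (c : n) :
    (Matrix.scalar n (v c) - Matrix.diagonal v).adjugate =
      Matrix.diagonal (Pi.single c (∏ b ∈ Finset.univ.erase c, (v c - v b))) := by
  rw [Matrix.scalar_apply, Matrix.diagonal_sub, Matrix.adjugate_diagonal]
  congr 1
  funext a
  by_cases h : a = c
  · subst h; simp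
  · rw [Pi.single_eq_of_ne h]
    exact Finset.prod_eq_zero (Finset.mem_erase.2 ⟨Ne.symm h, Finset.mem_univ c⟩) (sub_self _)

theorem eigenColumns_diagonal (v : n → B) (e : l → n) (a : n) (k : l) :
    eigenColumns (Matrix.diagonal v) (v ∘ e) a k =
      if a = e k then ∏ b ∈ Finset.univ.erase (e k), (v (e k) - v b) else 0 := by
  simp only [eigenColumns, Matrix.of_apply, Function.comp_apply, adjugate_scalar_sub_diagonal,
    Matrix.diagonal_apply]
  simp [Pi.single_apply]

theorem eigenRows_diagonal (v : n → B) (e : l → n) (a : n) (k : l) :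
    eigenRows (Matrix.diagonal v) (v ∘ e) k a =
      if a = e k then ∏ b ∈ Finset.univ.erase (e k), (v (e k) - v b) else 0 := by
  simp only [eigenRows, Matrix.of_apply, Function.comp_apply, adjugate_scalar_sub_diagonal,
    Matrix.diagonal_apply]
  simp [Pi.single_apply]

end Square

open Matrix in
/-- For square channels, `d` eigenvectors of the monodromy at the transmitters and left eigenvectors
for `d` other eigenvalues at the receivers give alignment with decoding. -/
theorem forGenericChannel_decodable_square {M d : ℕ} (hd : 2 * d ≤ M) :
    ForGenericChannel (fun H : InterferenceChannel M M => DecodableAlignmentFeasible H d) := by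
  let R := ChannelRing M M
  let L := AlgebraicClosure (FractionRing R)
  let B := integralClosure R L
  have hRL : Function.Injective (algebraMap R L) := by
    rw [IsScalarTower.algebraMap_eq R (FractionRing R) L]
    exact (algebraMap (FractionRing R) L).injective.comp (IsFractionRing.injective R _)
  have hRB : Function.Injective (algebraMap R B) := by
    intro x y h
    exact hRL (congrArg Subtype.val h)
  have : FaithfulSMul R B := (faithfulSMul_iff_algebraMap_injective R B).2 hRB
  let v : Fin M → ℂ := fun a => (a : ℕ)
  have hv : Function.Injective v := fun a b h => Fin.ext (Nat.cast_injective h)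
  -- The special channel: the monodromy is diagonal with distinct eigenvalues, and the direct links
  -- carry the first `d` antennas to the next `d` ones.
  let K : Matrix (Fin M) (Fin M) ℂ := Matrix.of fun a b => if (a : ℕ) = d + b then 1 else 0
  let H₀ : InterferenceChannel M M := fun i j =>
    if i = j then K else if i = 2 ∧ j = 1 then Matrix.diagonal v else 1
  obtain ⟨ψ, hψ⟩ := exists_ringHom_extension_of_isIntegral (B := B) (evalChannel H₀)
    (evalChannel_surjective H₀)
  let G : Fin 3 → Fin 3 → Matrix (Fin M) (Fin M) B :=
    fun i j => (genericChannel M M i j).map (algebraMap R B)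
  have hG : ∀ i j, (G i j).map ψ = H₀ i j := by
    intro i j
    rw [← genericChannel_map_eval H₀ i j]
    ext a b
    exact hψ _
  let T := interferenceCycle G
  have hT : T.map ψ = Matrix.diagonal v := by
    simp only [T, interferenceCycle, Matrix.map_mul, map_adjugate_apply, hG]
    simp [H₀]
  obtain ⟨t, ht⟩ := exists_multiset_prod_of_monic_integralClosure T.charpoly T.charpoly_monic
  have hroot : ∀ a, ∃ μ : B, T.charpoly.eval μ = 0 ∧ ψ μ = v a := by
    intro a
    refine exists_root_of_root_map ψ T.charpoly t ht (v a) ?_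
    rw [← Matrix.charpoly_map, hT, Matrix.charpoly_diagonal, Polynomial.eval_prod]
    exact Finset.prod_eq_zero (Finset.mem_univ a) (by simp)
  -- Each eigenvalue is labelled by its value at the special channel.
  choose μ hμ hψμ using hroot
  have hψμ' : ψ ∘ μ = v := funext hψμ
  have hμinj : Function.Injective μ := by
    intro a b h
    exact hv (by rw [← hψμ, ← hψμ, h])
  let e : Fin d → Fin M := fun k => ⟨k, by omega⟩
  let e' : Fin d → Fin M := fun k => ⟨d + k, by omega⟩
  let X := eigenColumns T (μ ∘ e)
  let Y := eigenRows T (μ ∘ e')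
  have hX : T * X = X * Matrix.diagonal (μ ∘ e) := mul_eigenColumns T _ fun k => hμ _
  have hYX : Y * X = 0 := by
    refine eigenRows_mul_eigenColumns T _ _ (fun k => hμ _) (fun k => hμ _) fun k k' h => ?_
    have h1 := congrArg Fin.val (hμinj h)
    simp only [e, e'] at h1
    omega
  refine forGenericChannel_of_frames (B := B) (cycleTransmit G X) (cycleReceive G Y)
    (cycleReceive_mul_cycleTransmit G X Y _ hX hYX) fun i h => ?_
  have hPψ : (cycleTransmit G X i).map ψ = X.map ψ := by
    fin_cases i <;>
      simp [cycleTransmit, Matrix.map_mul, map_adjugate_apply, hG, H₀]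
  have hQψ : (cycleReceive G Y i).map ψ = Y.map ψ := by
    fin_cases i <;>
      simp [cycleReceive, Matrix.map_mul, map_adjugate_apply, hG, H₀]
  have h1 := congrArg ψ h
  rw [RingHom.map_det, RingHom.mapMatrix_apply, map_zero, Matrix.map_mul, Matrix.map_mul, hPψ,
    hQψ] at h1
  have hKi : (G i i).map ψ = K := by rw [hG]; simp [H₀]
  let w : Fin M → ℂ := fun c => ∏ b ∈ Finset.univ.erase c, (v c - v b)
  have hw : ∀ c, w c ≠ 0 := fun c => Finset.prod_ne_zero_iff.2 fun b hb =>
    sub_ne_zero.2 fun h => (Finset.mem_erase.1 hb).1 (hv h).symm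
  have h2 : Y.map ψ * K * X.map ψ = Matrix.diagonal fun k => w (e' k) * w (e k) := by
    rw [eigenRows_map, eigenColumns_map, hT, ← Function.comp_assoc, ← Function.comp_assoc, hψμ']
    ext k k'
    simp only [Matrix.mul_apply, eigenColumns_diagonal, eigenRows_diagonal, ite_mul, zero_mul,
      mul_ite, mul_zero, Finset.sum_ite_eq', Finset.mem_univ, if_true]
    by_cases hk : k = k'
    · subst hk
      simp [K, e, e', w]
    · have : (k : ℕ) ≠ k' := fun h => hk (Fin.ext h)
      simp [K, e, e', hk, this]
  change (Y.map ψ * (G i i).map ψ * X.map ψ).det = 0 at h1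
  rw [hKi, h2, Matrix.det_diagonal] at h1
  exact Finset.prod_ne_zero_iff.2 (fun k _ => mul_ne_zero (hw _) (hw _)) h1

/-! ### The inequalities and the theorem -/

theorem ForGenericChannel.mono {N M : ℕ} {P P' : InterferenceChannel N M → Prop}
    (h : ForGenericChannel P) (hPP' : ∀ H, P H → P' H) : ForGenericChannel P' := by
  obtain ⟨p, hp, hP⟩ := h
  exact ⟨p, hp, fun H hH => hPP' H (hP H hH)⟩

theorem DecodableAlignmentFeasible.alignmentFeasible {N M d : ℕ} {H : InterferenceChannel N M}
    (h : DecodableAlignmentFeasible H d) : AlignmentFeasible H d := by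
  obtain ⟨U, V, hUV, -⟩ := h
  exact ⟨U, V, hUV⟩

theorem decodableAlignmentFeasible_zero {N M : ℕ} (H : InterferenceChannel N M) :
    DecodableAlignmentFeasible H 0 :=
  decodableAlignmentFeasible_of_frames H (fun _ => 0) (fun _ => 0) (fun _ _ _ => by simp)
    (fun _ => by simp)

theorem two_mul_le_of_forall_le_square {M d : ℕ}
    (h : ∀ r : ℕ, (2 * r + 1) * d ≤ max (r * M) ((r + 1) * M)) : 2 * d ≤ M := by
  -- The inequalities tend to `2 * d ≤ M` as `r → ∞`, and `r = M` is already large enough.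
  have h1 := h M
  rw [max_eq_right (Nat.mul_le_mul_right M (Nat.le_succ M))] at h1
  by_contra! h2
  nlinarith

theorem two_mul_lt_of_forall_le {M s d : ℕ} (hs : 0 < s) (hd : 0 < d)
    (h : ∀ r : ℕ, (2 * r + 1) * d ≤ max (r * (M + s)) ((r + 1) * M)) : 2 * d < M + s := by
  have h1 := h M
  rw [max_eq_left (by nlinarith)] at h1
  by_contra! h2
  nlinarith

/-- With `q ≤ N - 2 * d` chains, the inequality for `r = n / q` says that the chains fit into the
transmit space up to their `d`-th vector. -/
theorem chainIndex_lt {M s d q n : ℕ} (hqs : q ≤ s) (hqd : q ≤ d) (hn : n < d)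
    (hq : q = s ∨ q = d ∨ 2 * d + q = M + s)
    (h : ∀ r : ℕ, (2 * r + 1) * d ≤ max (r * (M + s)) ((r + 1) * M)) :
    chainIndex q s n < M := by
  have hdM : d ≤ M := by simpa using h 0
  have hmod := Nat.div_add_mod n q
  rcases hq with rfl | rfl | hq
  · rw [chainIndex, mul_comm, hmod]
    omega
  · rw [chainIndex, Nat.div_eq_of_lt hn, Nat.mod_eq_of_lt hn]
    omega
  · have hr := h (n / q)
    rw [chainIndex]
    generalize n / q = K at *
    generalize n % q = a at *
    rcases le_max_iff.1 hr with h1 | h1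
    · rw [← hq] at h1
      nlinarith
    · have h2 : K * (2 * d + q) = K * (M + s) := by rw [hq]
      nlinarith

theorem forGenericChannel_decodable_of_forall_le {M s d : ℕ}
    (h : ∀ r : ℕ, (2 * r + 1) * d ≤ max (r * (M + s)) ((r + 1) * M)) :
    ForGenericChannel (fun H : InterferenceChannel (M + s) M =>
      DecodableAlignmentFeasible H d) := by
  rcases Nat.eq_zero_or_pos d with rfl | hd
  · exact ⟨1, one_ne_zero, fun H _ => decodableAlignmentFeasible_zero H⟩
  rcases Nat.eq_zero_or_pos s with rfl | hs
  · exact forGenericChannel_decodable_square (two_mul_le_of_forall_le_square h)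
  have h2 := two_mul_lt_of_forall_le hs hd h
  obtain ⟨q, hq⟩ : ∃ q, q = min (min s d) (M + s - 2 * d) := ⟨_, rfl⟩
  obtain ⟨m, rfl⟩ : ∃ m, d = m + q := ⟨d - q, by omega⟩
  exact forGenericChannel_decodable_of_chains (by omega) (by omega) (by omega)
    fun n hn => chainIndex_lt (by omega) (by omega) hn (by omega) h

theorem theorem1 (M N d : ℕ) (hMN : M ≤ N) :
    ForGenericChannel (fun H : InterferenceChannel N M =>
      (AlignmentFeasible H d ↔
        ∀ r : ℕ, (2 * r + 1) * d ≤ max (r * N) ((r + 1) * M)) ∧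
      (DecodableAlignmentFeasible H d ↔
        ∀ r : ℕ, (2 * r + 1) * d ≤ max (r * N) ((r + 1) * M))) := by
  obtain ⟨s, rfl⟩ := Nat.exists_eq_add_of_le hMN
  by_cases h : ∀ r : ℕ, (2 * r + 1) * d ≤ max (r * (M + s)) ((r + 1) * M)
  · exact (forGenericChannel_decodable_of_forall_le h).mono fun H hH =>
      ⟨iff_of_true hH.alignmentFeasible h, iff_of_true hH h⟩
  · -- One violated inequality suffices, so that a single polynomial does.
    obtain ⟨r, hr⟩ := not_forall.1 h
    refine (forGenericChannel_le_of_alignmentFeasible M s d r).mono fun H hH => ?_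
    have hH' : ¬ AlignmentFeasible H d := fun hf => hr (hH hf)
    exact ⟨iff_of_false hH' h, iff_of_false (fun hf => hH' hf.alignmentFeasible) h⟩
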